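/- All alphabets are finite, and $\mathfrak A^*$ denotes the free monoid on $\mathfrak A$. A *correspondence* between $\mathfrak B^*$ and $\mathfrak C^*$ is a quadruple $X=(\mathfrak A,\alpha,\beta,\mathcal K)$ with monoid homomorphisms $\alpha:\mathfrak A^*\to\mathfrak B^*$, $\beta:\mathfrak A^*\to\mathfrak C^*$ and a language $\mathcal K\subset\mathfrak A^*$. It defines the subset $\{(\alpha(w),\beta(w)) : w\in\mathcal K\}\subset\mathfrak B^*\times\mathfrak C^*$, and it maps $\Omega\subset\mathfrak B^*$ to $X(\Omega)=\beta(\alpha^{-1}(\Omega)\cap\mathcal K)$. It is a *rational transduction* if $\mathcal K$ is regular. For $Y=(\mathfrak A',\alpha',\beta',\mathcal K')$ between $\mathfrak C^*$ and $\mathfrak D^*$ the fibred product is $$Y\circ X=(\mathfrak A\sqcup\mathfrak A',\ \alpha\circ\pi_{\mathfrak A},\ \beta'\circ\pi_{\mathfrak A'},\ \hat{\mathcal K}),\qquad \hat{\mathcal K}=\{w : \pi_{\mathfrak A}(w)\in\mathcal K,\ \pi_{\mathfrak A'}(w)\in\mathcal K',\ \beta(\pi_{\mathfrak A}(w))=\alpha'(\pi_{\mathfrak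 A'}(w))\},$$ where $\pi_{\mathfrak A},\pi_{\mathfrak A'}$ are the projections from $(\mathfrak A\sqcup\mathfrak A')^*$ that erase the letters of the other alphabet. For context-free languages $\mathcal L\subset\mathfrak B^*$, $\mathcal L'\subset\mathfrak C^*$, a rational transduction $X$ is *admissible* from $\mathcal L$ to $\mathcal L'$ if $\mathcal L\subset\alpha(\mathfrak A^*)$, $\mathcal L'\subset\beta(\mathfrak A^*)$ and $X(\mathcal L)\subset\mathcal L'$. A morphism $\mathcal L\to\mathcal L'$ is a subset of $\mathfrak B^*\times\mathfrak C^*$ defined by some admissible rational transduction. **Theorem.** 1. If $X$ is a rational transduction between $\mathfrak B^*$ and $\mathfrak C^*$ and $\Omega\subset\mathfrak B^*$ is regular (respectively context-free), then $X(\Omega)$ is regular (respectively context-free). 2. If $X$ is admissible from $\mathcal L$ to $\mathcal L'$ and $Y$ is admissible from $\mathcal L'$ to $\mathcal L''$, then $(Y\circ X)(\mathcal L)=Y(X(\mathcal L))$, and there is a regular language $\mathcal K_0\subset\hat{\mathcal K}$ such that $(\mathfrak A\sqcup\mathfrak A',\alpha\circ\pi_{\mathfrak A},\beta'\circ\pi_{\mathfrak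 A'},\mathcal K_0)$ is admissible from $\mathcal L$ to $\mathcal L''$ and defines the same subset of $\mathfrak B^*\times\mathfrak D^*$ as $Y\circ X$. 3. For composable correspondences $X_1,X_2,X_3$ with alphabets $\mathfrak A_1,\mathfrak A_2,\mathfrak A_3$, the relabelling $(\mathfrak A_1\sqcup\mathfrak A_2)\sqcup\mathfrak A_3\cong\mathfrak A_1\sqcup(\mathfrak A_2\sqcup\mathfrak A_3)$ identifies $X_3\circ(X_2\circ X_1)$ with $(X_3\circ X_2)\circ X_1$. 4. Context-free languages $\mathcal L\subset\mathfrak B^*$ and their morphisms form a category $\mathcal{CFL}$: the identity of $\mathcal L\subset\mathfrak B^*$ is the diagonal of $\mathfrak B^*\times\mathfrak B^*$, and the composite of two morphisms is the subset defined by the fibred product $Y\circ X$ of any correspondences $X$, $Y$ that define them. -/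

import Mathlib

universe u

namespace CFL

/-- A quadruple `(A, α, β, K)`: a finite alphabet `A`, two morphisms of free monoids
`α : A* → B*`, `β : A* → C*` and a language `K ⊆ A*`. It is a rational transduction when `K` is
regular; regularity is kept apart because the fibred product of two rational transductions is
first of all a quadruple of this kind. -/
structure Correspondence (B C : Type u) where
  alphabet : Type u
  finite_alphabet : Finite alphabet
  α : FreeMonoid alphabet →* FreeMonoid B
  β : FreeMonoid alphabet →* FreeMonoid C
  lang : Language alphabet

/-- The projection `(A ⊔ A')* → A*` that erases the letters of `A'`. -/
def projLeft (A A' : Type u) : FreeMonoid (A ⊕ A') →* FreeMonoid A :=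
  FreeMonoid.lift (Sum.elim FreeMonoid.of (fun _ => 1))

/-- The projection `(A ⊔ A')* → A'*` that erases the letters of `A`. -/
def projRight (A A' : Type u) : FreeMonoid (A ⊕ A') →* FreeMonoid A' :=
  FreeMonoid.lift (Sum.elim (fun _ => 1) FreeMonoid.of)

namespace Correspondence

variable {B C D : Type u}

/-- The quadruple is a rational transduction: its language is regular. -/
def IsRational (X : Correspondence B C) : Prop :=
  X.lang.IsRegular

/-- The subset `{(α(w), β(w)) | w ∈ K}` of `B* × C*` with which the quadruple is identified. -/
def rel (X : Correspondence B C) : Set (FreeMonoid B × FreeMonoid C) :=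
  {p | ∃ w : FreeMonoid X.alphabet, w.toList ∈ X.lang ∧ p = (X.α w, X.β w)}

/-- `X(Ω) = β(α⁻¹(Ω) ∩ K)`. -/
def image (X : Correspondence B C) (Ω : Language B) : Language C :=
  {v : List C | ∃ w : FreeMonoid X.alphabet,
    (X.α w).toList ∈ Ω ∧ w.toList ∈ X.lang ∧ (X.β w).toList = v}

/-- The same alphabet and morphisms with another language. -/
def withLang (X : Correspondence B C) (K : Language X.alphabet) : Correspondence B C where
  alphabet := X.alphabet
  finite_alphabet := X.finite_alphabet
  α := X.α
  β := X.β
  lang := K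

/-- The fibred product `Y ∘ X = (A ⊔ A', α ∘ π, β' ∘ π', K̂)` of `X = (A, α, β, K)` and
`Y = (A', α', β', K')`, where `K̂` is the set of the words `w` over the disjoint union `A ⊔ A'`
with `π(w) ∈ K`, `π'(w) ∈ K'` and `β(π(w)) = α'(π'(w))`. -/
def comp (Y : Correspondence C D) (X : Correspondence B C) : Correspondence B D where
  alphabet := X.alphabet ⊕ Y.alphabet
  finite_alphabet :=
    haveI := X.finite_alphabet
    haveI := Y.finite_alphabet
    inferInstance
  α := X.α.comp (projLeft X.alphabet Y.alphabet)
  β := Y.β.comp (projRight X.alphabet Y.alphabet)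
  lang := {w : List (X.alphabet ⊕ Y.alphabet) |
    (projLeft X.alphabet Y.alphabet (FreeMonoid.ofList w)).toList ∈ X.lang ∧
    (projRight X.alphabet Y.alphabet (FreeMonoid.ofList w)).toList ∈ Y.lang ∧
    X.β (projLeft X.alphabet Y.alphabet (FreeMonoid.ofList w)) =
      Y.α (projRight X.alphabet Y.alphabet (FreeMonoid.ofList w))}

/-- `X'` arises from `X` by relabelling the letters of the alphabet along the bijection `e`. -/
def IsRelabelling (X X' : Correspondence B C) (e : X.alphabet ≃ X'.alphabet) : Prop :=
  X'.α.comp (FreeMonoid.map e) = X.α ∧ X'.β.comp (FreeMonoid.map e) = X.β ∧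
    ∀ w : FreeMonoid X.alphabet, w.toList ∈ X.lang ↔ (FreeMonoid.map e w).toList ∈ X'.lang

end Correspondence

/-- A context-free language over a finite alphabet. -/
structure CFLang where
  alphabet : Type u
  finite_alphabet : Finite alphabet
  lang : Language alphabet
  isContextFree : lang.IsContextFree

/-- `X = (A, α, β, K)` is a rational transduction that defines a morphism from `L ⊆ B*` to
`L' ⊆ C*`: `K` is regular, `L ⊆ α(A*)`, `L' ⊆ β(A*)` and `X(L) ⊆ L'`. -/
structure Correspondence.IsMorphism (L L' : CFLang.{u})
    (X : Correspondence L.alphabet L'.alphabet) : Prop where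
  rational : X.IsRational
  source_le : ∀ v ∈ L.lang, ∃ w : FreeMonoid X.alphabet, (X.α w).toList = v
  target_le : ∀ v ∈ L'.lang, ∃ w : FreeMonoid X.alphabet, (X.β w).toList = v
  image_le : X.image L.lang ≤ L'.lang

/-- The morphisms from `L ⊆ B*` to `L' ⊆ C*`: the subsets of `B* × C*` that are defined by a
rational transduction `(A, α, β, K)` with `L ⊆ α(A*)`, `L' ⊆ β(A*)` and `X(L) ⊆ L'`. -/
@[ext]
structure Mor (L L' : CFLang.{u}) where
  rel : Set (FreeMonoid L.alphabet × FreeMonoid L'.alphabet)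
  exists_rational : ∃ X : Correspondence L.alphabet L'.alphabet, X.IsMorphism L L' ∧ X.rel = rel

end CFL

/-!
A correspondence acts through the relation `Correspondence.rel` that it defines: `image` is the
direct image under that relation, and the fibred product defines the composite relation
(`rel_comp`), because any two words over `A` and `A'` with the same image in `C*` have a shuffle.
Hence the fibred product acts as the composite map, the subset that it defines depends only on the
subsets defined by its factors, and the axioms of a category are those of composition of relations.

The language of the fibred product of two rational transductions need not be regular. It has a
regular part that defines the same relation: when `β(u) = α'(v)`, one can shuffle `u` and `v` such
that at every moment the word read in `C*` through `β` is ahead of the one read through `α'` by a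
word of bounded length. An automaton remembers that word (`delayDFA`), so that these
shuffles form a regular language (`exists_isRegular_shuffle`).

Regular languages are preserved by inverse morphisms, by intersection, and by morphisms. For the
last case the left quotients of the image are counted (`isRegular_image`).

For a context-free `Ω`, the rational transduction is turned into a finite transducer whose state
consists of a state of an automaton for `K` and of the part of `α(w)` not yet matched with the
input. The image is then generated by the grammar of triples `(p, X, q)`, which stand for what is
written on the way from the state `p` to the state `q` while a word derived from `X` is read
(`isContextFree_run`). Both inclusions are inductions on a big-step form of derivations, `Yields`.
-/

namespace CFL

/-! ### Morphisms of free monoids on words -/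

section Words

variable {A B : Type*}

/-- A morphism of free monoids `A* → B*`, viewed as a function on lists. -/
def onWords (f : FreeMonoid A →* FreeMonoid B) (w : List A) : List B :=
  (f (FreeMonoid.ofList w)).toList

@[simp]
lemma onWords_nil (f : FreeMonoid A →* FreeMonoid B) : onWords f [] = [] := by
  simp [onWords]

lemma onWords_append (f : FreeMonoid A →* FreeMonoid B) (v w : List A) :
    onWords f (v ++ w) = onWords f v ++ onWords f w := by
  simp [onWords]

@[simp]
lemma onWords_cons (f : FreeMonoid A →* FreeMonoid B) (a : A) (w : List A) :
    onWords f (a :: w) = (f (FreeMonoid.of a)).toList ++ onWords f w := by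
  simp [onWords, FreeMonoid.ofList_cons]

lemma exists_length_le [Finite A] (f : FreeMonoid A →* FreeMonoid B) :
    ∃ N : ℕ, ∀ a, (f (FreeMonoid.of a)).toList.length ≤ N := by
  obtain ⟨N, hN⟩ := (Set.finite_range fun a => (f (FreeMonoid.of a)).toList.length).bddAbove
  exact ⟨N, fun a => hN ⟨a, rfl⟩⟩

/-- A factorization of `f(w)` lifts to a factorization of `w`, up to a word `t` no longer than the
image of a letter. -/
lemma exists_split_of_onWords_eq_append (f : FreeMonoid A →* FreeMonoid B) {N : ℕ}
    (hN : ∀ a, (f (FreeMonoid.of a)).toList.length ≤ N) (w : List A) (v u : List B)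
    (h : onWords f w = v ++ u) :
    ∃ w₁ w₂ t, w = w₁ ++ w₂ ∧ onWords f w₁ = v ++ t ∧ u = t ++ onWords f w₂ ∧ t.length ≤ N := by
  induction w generalizing v with
  | nil => exact ⟨[], [], [], by simp_all⟩
  | cons a w ih =>
    rw [onWords_cons, List.append_eq_append_iff] at h
    rcases h with ⟨v', rfl, h⟩ | ⟨t, h, rfl⟩
    · obtain ⟨w₁, w₂, t, rfl, h₁, h₂, h₃⟩ := ih v' h
      exact ⟨a :: w₁, w₂, t, rfl, by simp [h₁], h₂, h₃⟩
    · refine ⟨[a], w, t, rfl, by simp [h], rfl, ?_⟩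
      have := hN a
      rw [h, List.length_append] at this
      omega

end Words

/-! ### Regular languages under morphisms -/

section Regular

variable {A B : Type*}

lemma isRegular_preimage (f : FreeMonoid A →* FreeMonoid B) {L : Language B} (hL : L.IsRegular) :
    Language.IsRegular ({w | onWords f w ∈ L} : Language A) := by
  obtain ⟨σ, _, M, rfl⟩ := hL
  let M' : DFA A σ := ⟨fun s a => M.evalFrom s (f (FreeMonoid.of a)).toList, M.start, M.accept⟩
  have key : ∀ (w : List A) (s : σ), M'.evalFrom s w = M.evalFrom s (onWords f w) := by
    intro w
    induction w with
    | nil => simp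
    | cons a w ih =>
      intro s
      rw [DFA.evalFrom_cons, ih, onWords_cons, DFA.evalFrom_of_append]
  refine ⟨σ, inferInstance, M', ?_⟩
  ext w
  change M'.evalFrom M'.start w ∈ M.accept ↔ M.evalFrom M.start (onWords f w) ∈ M.accept
  rw [key]

/-- The image of a regular language under a morphism is regular. The left quotient of the image by
`v` depends only on the finite set of the pairs `(t, q)` where `t` is short, and where some word
`w` with image `v ++ t` leads an automaton of the language to the state `q`. -/
lemma isRegular_image [Finite A] [Finite B] (f : FreeMonoid A →* FreeMonoid B) {L : Language A}
    (hL : L.IsRegular) :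
    Language.IsRegular ({v | ∃ w ∈ L, onWords f w = v} : Language B) := by
  obtain ⟨σ, _, M, rfl⟩ := hL
  obtain ⟨N, hN⟩ := exists_length_le f
  let S : List B → Set (List B × σ) := fun v =>
    {p | p.1.length ≤ N ∧ ∃ w, onWords f w = v ++ p.1 ∧ M.eval w = p.2}
  let G : Set (List B × σ) → Language B := fun S =>
    {u | ∃ p ∈ S, ∃ w, M.evalFrom p.2 w ∈ M.accept ∧ u = p.1 ++ onWords f w}
  have hfin : ({t : List B | t.length ≤ N} ×ˢ (Set.univ : Set σ)).Finite :=
    (List.finite_length_le B N).prod Set.finite_univ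
  refine Language.IsRegular.of_finite_range_leftQuotient
    ((hfin.finite_subsets.image G).subset ?_)
  rintro _ ⟨v, rfl⟩
  refine ⟨S v, fun p hp => ⟨hp.1, trivial⟩, ?_⟩
  ext u
  constructor
  · rintro ⟨⟨t, q⟩, ⟨-, w₁, h₁, rfl⟩, w₂, h₂, rfl⟩
    refine ⟨w₁ ++ w₂, ?_, ?_⟩
    · change M.evalFrom M.start (w₁ ++ w₂) ∈ M.accept
      rw [DFA.evalFrom_of_append]
      exact h₂
    · rw [onWords_append, h₁, List.append_assoc]
  · rintro ⟨w, hw, h⟩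
    obtain ⟨w₁, w₂, t, rfl, h₁, rfl, ht⟩ := exists_split_of_onWords_eq_append f hN w v u h
    refine ⟨(t, M.eval w₁), ⟨ht, w₁, h₁, rfl⟩, w₂, ?_, rfl⟩
    change M.evalFrom M.start (w₁ ++ w₂) ∈ M.accept at hw
    rwa [DFA.evalFrom_of_append] at hw

end Regular

/-! ### Shuffles with bounded delay -/

section Shuffle

@[simp]
lemma projLeft_of_inl {A A' : Type u} (a : A) :
    projLeft A A' (FreeMonoid.of (Sum.inl a)) = FreeMonoid.of a :=
  rfl

@[simp]
lemma projLeft_of_inr {A A' : Type u} (a : A') : projLeft A A' (FreeMonoid.of (Sum.inr a)) = 1 :=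
  rfl

@[simp]
lemma projRight_of_inl {A A' : Type u} (a : A) : projRight A A' (FreeMonoid.of (Sum.inl a)) = 1 :=
  rfl

@[simp]
lemma projRight_of_inr {A A' : Type u} (a : A') :
    projRight A A' (FreeMonoid.of (Sum.inr a)) = FreeMonoid.of a :=
  rfl

variable {A A' C : Type u} (f : FreeMonoid A →* FreeMonoid C) (g : FreeMonoid A' →* FreeMonoid C)
  (N : ℕ)

open Classical in
/-- The automaton on `(A ⊔ A')*` whose state after reading `w` is the word `t` with
`f(π(w)) = g(π'(w)) t`. It fails, in the state `none`, as soon as there is no such `t` or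
`t` is longer than `N`; it accepts when `t` is empty. -/
noncomputable def delayDFA : DFA (A ⊕ A') (Option {t : List C // t.length ≤ N}) where
  step
    | none, _ => none
    | some t, Sum.inl a =>
      if h : (t.1 ++ (f (FreeMonoid.of a)).toList).length ≤ N then some ⟨_, h⟩ else none
    | some t, Sum.inr a =>
      if h : ∃ t' : {t : List C // t.length ≤ N}, t.1 = (g (FreeMonoid.of a)).toList ++ t'.1
      then some h.choose else none
  start := some ⟨[], Nat.zero_le N⟩
  accept := {some ⟨[], Nat.zero_le N⟩}

lemma evalFrom_delayDFA_none (w : List (A ⊕ A')) : (delayDFA f g N).evalFrom none w = none := by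
  induction w with
  | nil => rfl
  | cons a w ih => exact ih

lemma delayDFA_sound (w : List (A ⊕ A')) (t t' : {t : List C // t.length ≤ N})
    (h : (delayDFA f g N).evalFrom (some t) w = some t') :
    t.1 ++ onWords f (onWords (projLeft A A') w) =
      onWords g (onWords (projRight A A') w) ++ t'.1 := by
  induction w generalizing t with
  | nil => simp_all
  | cons x w ih =>
    rw [DFA.evalFrom_cons] at h
    rcases x with a | a
    · by_cases hN : (t.1 ++ (f (FreeMonoid.of a)).toList).length ≤ N
      · have hs : (delayDFA f g N).step (some t) (Sum.inl a) = some ⟨_, hN⟩ := dif_pos hN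
        rw [hs] at h
        simpa using ih _ h
      · have hs : (delayDFA f g N).step (some t) (Sum.inl a) = none := dif_neg hN
        rw [hs, evalFrom_delayDFA_none] at h
        cases h
    · by_cases he : ∃ t' : {t : List C // t.length ≤ N}, t.1 = (g (FreeMonoid.of a)).toList ++ t'.1
      · have hs : (delayDFA f g N).step (some t) (Sum.inr a) = some he.choose := dif_pos he
        rw [hs] at h
        have h₁ := ih _ h
        have h₂ := he.choose_spec
        simp only [onWords_cons, projLeft_of_inr, projRight_of_inr, FreeMonoid.toList_one,
          List.nil_append, FreeMonoid.toList_of, List.singleton_append, List.append_assoc]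
        rw [← h₁, ← List.append_assoc, ← h₂]
      · have hs : (delayDFA f g N).step (some t) (Sum.inr a) = none := dif_neg he
        rw [hs, evalFrom_delayDFA_none] at h
        cases h

/-- Two words with the same image in `C*` have a shuffle of bounded delay. The shuffle takes a
letter of `A'` as soon as its image is a prefix of the delay `t`, and a letter of `A` otherwise;
in the latter case `t` is no longer than the image of a letter of `A'`, or `A'` is used up and `t` is
empty. -/
lemma exists_shuffle_evalFrom_delayDFA {Nf Ng : ℕ}
    (hf : ∀ a, (f (FreeMonoid.of a)).toList.length ≤ Nf)
    (hg : ∀ a, (g (FreeMonoid.of a)).toList.length ≤ Ng) (v : List A') (u : List A)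
    (t : {t : List C // t.length ≤ Ng + Nf}) (h : t.1 ++ onWords f u = onWords g v) :
    ∃ w : List (A ⊕ A'), onWords (projLeft A A') w = u ∧ onWords (projRight A A') w = v ∧
      (delayDFA f g (Ng + Nf)).evalFrom (some t) w = some ⟨[], Nat.zero_le _⟩ := by
  induction v generalizing u t with
  | nil =>
    induction u generalizing t with
    | nil => exact ⟨[], by simp, by simp, by simpa [Subtype.ext_iff] using h⟩
    | cons a u ih =>
      obtain ⟨ht, ha, hu⟩ : t.1 = [] ∧ (f (FreeMonoid.of a)).toList = [] ∧ onWords f u = [] := by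
        simpa using h
      obtain ⟨w, h₁, h₂, h₃⟩ := ih t (by simp [ht, hu])
      refine ⟨Sum.inl a :: w, by simp [h₁], by simp [h₂], ?_⟩
      have hN : (t.1 ++ (f (FreeMonoid.of a)).toList).length ≤ Ng + Nf := by simp [ht, ha]
      have hs : (delayDFA f g (Ng + Nf)).step (some t) (Sum.inl a) = some ⟨_, hN⟩ := dif_pos hN
      rw [DFA.evalFrom_cons, hs, ← h₃]
      congr 2
      simp [ha]
  | cons b v ihv =>
    induction u generalizing t with
    | nil =>
      have ht : t.1 = (g (FreeMonoid.of b)).toList ++ onWords g v := by simpa using h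
      have he : ∃ t' : {t : List C // t.length ≤ Ng + Nf},
          t.1 = (g (FreeMonoid.of b)).toList ++ t'.1 := by
        refine ⟨⟨onWords g v, ?_⟩, ht⟩
        have := t.2
        rw [ht, List.length_append] at this
        omega
      have hs : (delayDFA f g (Ng + Nf)).step (some t) (Sum.inr b) = some he.choose := dif_pos he
      obtain ⟨w, h₁, h₂, h₃⟩ := ihv [] he.choose (by
        simpa using (List.append_cancel_left (ht.symm.trans he.choose_spec)).symm)
      exact ⟨Sum.inr b :: w, by simp [h₁], by simp [h₂], by rw [DFA.evalFrom_cons, hs, h₃]⟩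
    | cons a u ihu =>
      by_cases he : ∃ t' : {t : List C // t.length ≤ Ng + Nf},
          t.1 = (g (FreeMonoid.of b)).toList ++ t'.1
      · have hs : (delayDFA f g (Ng + Nf)).step (some t) (Sum.inr b) = some he.choose := dif_pos he
        obtain ⟨w, h₁, h₂, h₃⟩ := ihv (a :: u) he.choose (by
          have := he.choose_spec
          rw [onWords_cons g] at h
          refine List.append_cancel_left (as := (g (FreeMonoid.of b)).toList) ?_
          rw [← h, ← List.append_assoc, ← this])
        exact ⟨Sum.inr b :: w, by simp [h₁], by simp [h₂], by rw [DFA.evalFrom_cons, hs, h₃]⟩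
      · have hlt : t.1.length ≤ Ng := by
          by_contra! hlt
          rw [onWords_cons g, List.append_eq_append_iff] at h
          rcases h with ⟨t', h, -⟩ | ⟨t', h, -⟩
          · have := hg b
            rw [h, List.length_append] at this
            omega
          · refine he ⟨⟨t', ?_⟩, h⟩
            have := t.2
            rw [h, List.length_append] at this
            omega
        have hN : (t.1 ++ (f (FreeMonoid.of a)).toList).length ≤ Ng + Nf := by
          rw [List.length_append]
          exact Nat.add_le_add hlt (hf a)
        have hs : (delayDFA f g (Ng + Nf)).step (some t) (Sum.inl a) = some ⟨_, hN⟩ := dif_pos hN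
        obtain ⟨w, h₁, h₂, h₃⟩ := ihu ⟨_, hN⟩ (by simpa using h)
        exact ⟨Sum.inl a :: w, by simp [h₁], by simp [h₂], by rw [DFA.evalFrom_cons, hs, h₃]⟩

/-- Among the words `w` over `A ⊔ A'` with `f(π(w)) = g(π'(w))` there is a regular language that
still contains a shuffle of every pair of words with the same image in `C*`. -/
lemma exists_isRegular_shuffle [Finite A] [Finite A'] [Finite C] :
    ∃ K : Language (A ⊕ A'), K.IsRegular ∧
      (∀ w ∈ K, onWords f (onWords (projLeft A A') w) = onWords g (onWords (projRight A A') w)) ∧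
      ∀ u v, onWords f u = onWords g v →
        ∃ w ∈ K, onWords (projLeft A A') w = u ∧ onWords (projRight A A') w = v := by
  obtain ⟨Nf, hf⟩ := exists_length_le f
  obtain ⟨Ng, hg⟩ := exists_length_le g
  have : Finite {t : List C // t.length ≤ Ng + Nf} := List.finite_length_le C (Ng + Nf)
  refine ⟨(delayDFA f g (Ng + Nf)).accepts,
    Language.isRegular_iff.mpr ⟨_, Fintype.ofFinite _, _, rfl⟩, fun w hw => ?_, fun u v h => ?_⟩
  · simpa using delayDFA_sound f g (Ng + Nf) w ⟨[], Nat.zero_le _⟩ ⟨[], Nat.zero_le _⟩ hw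
  · obtain ⟨w, h₁, h₂, h₃⟩ := exists_shuffle_evalFrom_delayDFA f g hf hg v u
      ⟨[], Nat.zero_le _⟩ (by simpa using h)
    exact ⟨w, h₃, h₁, h₂⟩

end Shuffle

/-! ### Big-step semantics of context-free grammars -/

section Yields

variable {T N N' : Type*}

/-- `Yields R s w`: the rules `R` derive the word `w` from the string of symbols `s`, each symbol
of `s` deriving its own factor of `w`. The nonterminals may live in any universe. -/
inductive Yields (R : Set (ContextFreeRule T N)) : List (Symbol T N) → List T → Prop
  | nil : Yields R [] []
  | terminal (t : T) {s : List (Symbol T N)} {w : List T} (h : Yields R s w) :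
      Yields R (Symbol.terminal t :: s) (t :: w)
  | nonterminal {r : ContextFreeRule T N} (hr : r ∈ R) {s : List (Symbol T N)} {v w : List T}
      (hv : Yields R r.output v) (hw : Yields R s w) :
      Yields R (Symbol.nonterminal r.input :: s) (v ++ w)

namespace Yields

variable {R : Set (ContextFreeRule T N)}

lemma append {s s' : List (Symbol T N)} {w w' : List T} (h : Yields R s w) (h' : Yields R s' w') :
    Yields R (s ++ s') (w ++ w') := by
  induction h with
  | nil => exact h'
  | terminal t _ ih => exact ih.terminal t
  | nonterminal hr hv _ _ ih =>
    rw [List.append_assoc]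
    exact .nonterminal hr hv ih

lemma exists_of_append {s s' : List (Symbol T N)} {w : List T} (h : Yields R (s ++ s') w) :
    ∃ v v', w = v ++ v' ∧ Yields R s v ∧ Yields R s' v' := by
  induction s generalizing w with
  | nil => exact ⟨[], w, rfl, .nil, h⟩
  | cons x s ih =>
    cases h with
    | terminal t h =>
      obtain ⟨v, v', rfl, h₁, h₂⟩ := ih h
      exact ⟨t :: v, v', rfl, h₁.terminal t, h₂⟩
    | nonterminal hr hv hw =>
      obtain ⟨v, v', rfl, h₁, h₂⟩ := ih hw
      exact ⟨_, v', (List.append_assoc _ _ _).symm, .nonterminal hr hv h₁, h₂⟩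

lemma map_terminal (R : Set (ContextFreeRule T N)) (w : List T) :
    Yields R (w.map Symbol.terminal) w := by
  induction w with
  | nil => exact .nil
  | cons t w ih => exact ih.terminal t

lemma of_rule {r : ContextFreeRule T N} (hr : r ∈ R) {w : List T} (h : Yields R r.output w) :
    Yields R [Symbol.nonterminal r.input] w := by
  simpa using Yields.nonterminal hr h .nil

end Yields

lemma derives_iff_yields (g : ContextFreeGrammar T) (s : List (Symbol T g.NT)) (w : List T) :
    g.Derives s (w.map Symbol.terminal) ↔ Yields {r | r ∈ g.rules} s w := by
  constructor
  · intro h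
    induction h using Relation.ReflTransGen.head_induction_on with
    | refl => exact .map_terminal _ w
    | head h _ ih =>
      obtain ⟨r, hr, h⟩ := h
      obtain ⟨p, q, rfl, rfl⟩ := h.exists_parts
      obtain ⟨v, v', rfl, h, h'⟩ := ih.exists_of_append
      obtain ⟨v, v'', rfl, h, h''⟩ := h.exists_of_append
      exact (h.append (.of_rule hr h'')).append h'
  · intro h
    induction h with
    | nil => exact Relation.ReflTransGen.refl
    | terminal t _ ih => exact ih.append_left [Symbol.terminal t]
    | @nonterminal r hr s v w _ _ ihv ihw =>
      have h₁ : g.Produces (Symbol.nonterminal r.input :: s) (r.output ++ s) :=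
        ⟨r, hr, .head s⟩
      rw [List.map_append]
      exact (h₁.single.trans (ihv.append_right s)).trans (ihw.append_left _)

/-- Renaming of the nonterminals in a symbol. -/
def mapSymbol (f : N → N') : Symbol T N → Symbol T N'
  | .terminal t => .terminal t
  | .nonterminal n => .nonterminal (f n)

/-- Renaming of the nonterminals in a rule. -/
def mapRule (f : N → N') (r : ContextFreeRule T N) : ContextFreeRule T N' :=
  ⟨f r.input, r.output.map (mapSymbol f)⟩

lemma Yields.map {R : Set (ContextFreeRule T N)} (f : N → N') {s : List (Symbol T N)} {w : List T}
    (h : Yields R s w) : Yields (mapRule f '' R) (s.map (mapSymbol f)) w := by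
  induction h with
  | nil => exact .nil
  | terminal t _ ih => exact ih.terminal t
  | nonterminal hr _ _ ihv ihw => exact .nonterminal (Set.mem_image_of_mem _ hr) ihv ihw

lemma mapSymbol_comp {N'' : Type*} (f : N → N') (g : N' → N'') :
    (mapSymbol g ∘ mapSymbol f : Symbol T N → Symbol T N'') = mapSymbol (g ∘ f) := by
  funext x
  cases x <;> rfl

lemma mapSymbol_id : (mapSymbol id : Symbol T N → Symbol T N) = id := by
  funext x
  cases x <;> rfl

/-- `ContextFreeGrammar` asks for nonterminals in `Type`; a finite set of rules over a small type
of nonterminals can be renamed accordingly. -/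
lemma isContextFree_of_yields [Small.{0} N] {R : Set (ContextFreeRule T N)} (hR : R.Finite)
    (S : N) : Language.IsContextFree ({w | Yields R [Symbol.nonterminal S] w} : Language T) := by
  classical
  let e := equivShrink.{0} N
  refine ⟨⟨Shrink.{0} N, e S, (hR.image (mapRule e)).toFinset⟩, ?_⟩
  ext w
  rw [ContextFreeGrammar.mem_language_iff, derives_iff_yields]
  simp only [Set.Finite.mem_toFinset, Set.ofPred_mem_eq]
  change _ ↔ Yields R _ w
  constructor
  · intro h
    have h' := h.map e.symm
    have hid : (mapRule e.symm ∘ mapRule e : ContextFreeRule T N → ContextFreeRule T N) = id := by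
      funext r
      simp [mapRule, mapSymbol_comp, mapSymbol_id]
    rw [← Set.image_comp, hid, Set.image_id] at h'
    simpa [mapSymbol] using h'
  · intro h
    exact h.map e

/-- The language of a string of symbols when each nonterminal `n` stands for the language `I n`. -/
def interp (I : N → Language T) : List (Symbol T N) → Language T
  | [] => 1
  | .terminal t :: s => {w | ∃ w' ∈ interp I s, w = t :: w'}
  | .nonterminal n :: s => I n * interp I s

/-- The language that rules generate is below every interpretation closed under the rules. -/
lemma Yields.mem_interp {R : Set (ContextFreeRule T N)} {I : N → Language T}
    (hI : ∀ r ∈ R, interp I r.output ≤ I r.input) {s : List (Symbol T N)} {w : List T}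
    (h : Yields R s w) : w ∈ interp I s := by
  induction h with
  | nil => exact Language.nil_mem_one
  | terminal t _ ih => exact ⟨_, ih, rfl⟩
  | nonterminal hr _ _ ihv ihw => exact Language.append_mem_mul (hI _ hr ihv) ihw

lemma mem_interp_singleton {I : N → Language T} {n : N} {w : List T} :
    w ∈ interp I [Symbol.nonterminal n] ↔ w ∈ I n := by
  simp [interp]

lemma mem_interp_map_terminal_append {I : N → Language T} {y w : List T} {s : List (Symbol T N)}
    (h : w ∈ interp I (y.map Symbol.terminal ++ s)) : ∃ z ∈ interp I s, w = y ++ z := by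
  induction y generalizing w with
  | nil => exact ⟨w, h, rfl⟩
  | cons t y ih =>
    obtain ⟨w', hw', rfl⟩ := h
    obtain ⟨z, hz, rfl⟩ := ih hw'
    exact ⟨z, hz, rfl⟩

instance small_symbol [Small.{0} T] [Small.{0} N] : Small.{0} (Symbol T N) :=
  small_map (β := T ⊕ N)
    { toFun := fun | .terminal t => .inl t | .nonterminal n => .inr n
      invFun := fun | .inl t => .terminal t | .inr n => .nonterminal n
      left_inv := by rintro (_ | _) <;> rfl
      right_inv := by rintro (_ | _) <;> rfl }

instance small_option [Small.{0} T] : Small.{0} (Option T) :=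
  small_map (Equiv.optionEquivSumPUnit.{0} T)

end Yields

/-! ### Finite transducers and context-free languages -/

section Transducer

variable {B C Q N : Type*}

/-- `Run emit read p x y q`: a transducer can go from the state `p` to the state `q` while it reads
`x` and writes `y`. A move `(p, y, p') ∈ emit` writes `y` and reads nothing; a move
`(p, b, p') ∈ read` reads the letter `b` and writes nothing. -/
inductive Run (emit : Set (Q × List C × Q)) (read : Set (Q × B × Q)) :
    Q → List B → List C → Q → Prop
  | nil (p : Q) : Run emit read p [] [] p
  | emit {p p' q : Q} {x : List B} {y z : List C} (h : (p, y, p') ∈ emit)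
      (hrun : Run emit read p' x z q) : Run emit read p x (y ++ z) q
  | read {p p' q : Q} {b : B} {x : List B} {z : List C} (h : (p, b, p') ∈ read)
      (hrun : Run emit read p' x z q) : Run emit read p (b :: x) z q

variable {emit : Set (Q × List C × Q)} {read : Set (Q × B × Q)}

lemma Run.append {p q r : Q} {x x' : List B} {y y' : List C} (h : Run emit read p x y q)
    (h' : Run emit read q x' y' r) : Run emit read p (x ++ x') (y ++ y') r := by
  induction h with
  | nil => exact h'
  | emit h _ ih =>
    rw [List.append_assoc]
    exact .emit h (ih h')
  | read h _ ih => exact .read h (ih h')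

lemma Run.exists_of_append {p q : Q} {x x' : List B} {y : List C}
    (h : Run emit read p (x ++ x') y q) :
    ∃ r v v', y = v ++ v' ∧ Run emit read p x v r ∧ Run emit read r x' v' q := by
  generalize hl : x ++ x' = l at h
  induction h generalizing x with
  | nil p =>
    obtain ⟨rfl, rfl⟩ := List.append_eq_nil_iff.mp hl
    exact ⟨p, [], [], rfl, .nil p, .nil p⟩
  | emit h _ ih =>
    obtain ⟨r, v, v', rfl, h₁, h₂⟩ := ih hl
    exact ⟨r, _, v', (List.append_assoc _ _ _).symm, .emit h h₁, h₂⟩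
  | @read p p' q b l z h hrun ih =>
    rcases x with _ | ⟨b', x⟩
    · obtain rfl : x' = b :: l := hl
      exact ⟨p, [], z, rfl, .nil p, .read h hrun⟩
    · obtain ⟨rfl, rfl⟩ := List.cons_eq_cons.mp hl
      obtain ⟨r, v, v', rfl, h₁, h₂⟩ := ih rfl
      exact ⟨r, v, v', rfl, .read h h₁, h₂⟩

/-- The nonterminals of the grammar for the image of a context-free language under a transducer:
the initial one, and triples `(p, X, q)` that stand for what is written on the way from `p` to `q`
while a word derived from the symbol `X` is read; `X = none` stands for the empty word. -/
abbrev TripleNT (B N Q : Type*) := Option (Q × Option (Symbol B N) × Q)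

/-- The strings of triples that distribute a path from `p` to `q` over the symbols of a string,
with a final triple for what is written after the last letter is read. -/
def threads (C : Type*) (q : Q) : Q → List (Symbol B N) → Set (List (Symbol C (TripleNT B N Q)))
  | p, [] => {[Symbol.nonterminal (some (p, none, q))]}
  | p, X :: s =>
    ⋃ r, (fun o => Symbol.nonterminal (some (p, some X, r)) :: o) '' threads C q r s

lemma finite_threads [Finite Q] (q p : Q) (s : List (Symbol B N)) : (threads C q p s).Finite := by
  induction s generalizing p with
  | nil => exact Set.finite_singleton _
  | cons X s ih => exact Set.finite_iUnion fun r => (ih r).image _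

/-- The data that determine a rule of the triple construction, for a grammar with the rules `R` and
the initial nonterminal `S`, and for the runs of a transducer from `p₀` to the states in `F`. -/
abbrev TripleIndex (emit : Set (Q × List C × Q)) (read : Set (Q × B × Q))
    (R : Set (ContextFreeRule B N)) (S : N) (p₀ : Q) (F : Set Q) :=
  Q ⊕ (emit × Option B × Q) ⊕ (read × Q) ⊕
    (Σ i : R × Q × Q, threads C i.2.2 i.2.1 i.1.1.output) ⊕
    (Σ q : F, threads C q.1 p₀ [Symbol.nonterminal (T := B) S])

/-- The rules of the triple construction. The first three generate what is written along paths that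
read at most one letter: the empty path, a path that starts with an emitting move, and a path that
starts with a reading move. The fourth expands a nonterminal of the given grammar by one of its
rules, and the last one rewrites the initial nonterminal. -/
def tripleRule (emit : Set (Q × List C × Q)) (read : Set (Q × B × Q))
    (R : Set (ContextFreeRule B N)) (S : N) (p₀ : Q) (F : Set Q) :
    TripleIndex emit read R S p₀ F → ContextFreeRule C (TripleNT B N Q)
  | .inl p => ⟨some (p, none, p), []⟩
  | .inr (.inl (m, X, q)) =>
    ⟨some (m.1.1, X.map Symbol.terminal, q),
      m.1.2.1.map Symbol.terminal ++
        [Symbol.nonterminal (some (m.1.2.2, X.map Symbol.terminal, q))]⟩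
  | .inr (.inr (.inl (m, q))) =>
    ⟨some (m.1.1, some (Symbol.terminal m.1.2.1), q),
      [Symbol.nonterminal (some (m.1.2.2, none, q))]⟩
  | .inr (.inr (.inr (.inl ⟨(r, p, q), o⟩))) =>
    ⟨some (p, some (Symbol.nonterminal r.1.input), q), o⟩
  | .inr (.inr (.inr (.inr ⟨_, o⟩))) => ⟨none, o⟩

variable {R : Set (ContextFreeRule B N)} {S : N} {p₀ : Q} {F : Set Q}

lemma finite_range_tripleRule [Finite Q] [Finite B] (hemit : emit.Finite) (hR : R.Finite) :
    (Set.range (tripleRule emit read R S p₀ F)).Finite := by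
  have := hemit.to_subtype
  have := hR.to_subtype
  have (q p : Q) (s : List (Symbol B N)) : Finite (threads C q p s) :=
    (finite_threads q p s).to_subtype
  exact Set.finite_range _

lemma yields_tripleRule (i : TripleIndex emit read R S p₀ F) {y : List C}
    (h : Yields (Set.range (tripleRule emit read R S p₀ F)) (tripleRule emit read R S p₀ F i).output
      y) :
    Yields (Set.range (tripleRule emit read R S p₀ F))
      [Symbol.nonterminal (tripleRule emit read R S p₀ F i).input] y :=
  .of_rule (Set.mem_range_self i) h

/-- The language that each nonterminal of the triple construction is meant to generate. -/
def tripleMeaning (emit : Set (Q × List C × Q)) (read : Set (Q × B × Q))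
    (R : Set (ContextFreeRule B N)) (S : N) (p₀ : Q) (F : Set Q) : TripleNT B N Q → Language C
  | none => {y | ∃ x, Yields R [Symbol.nonterminal S] x ∧ ∃ q ∈ F, Run emit read p₀ x y q}
  | some (p, X, q) => {y | ∃ x, Yields R X.toList x ∧ Run emit read p x y q}

lemma exists_run_of_mem_interp_threads {q p : Q} {s : List (Symbol B N)}
    {o : List (Symbol C (TripleNT B N Q))} (ho : o ∈ threads C q p s) {y : List C}
    (hy : y ∈ interp (tripleMeaning emit read R S p₀ F) o) :
    ∃ x, Yields R s x ∧ Run emit read p x y q := by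
  induction s generalizing p o y with
  | nil =>
    obtain rfl : o = _ := ho
    exact mem_interp_singleton.mp hy
  | cons X s ih =>
    obtain ⟨r, o, ho', rfl⟩ := Set.mem_iUnion.mp ho
    obtain ⟨y₁, ⟨x₁, h₁, hrun₁⟩, y₂, hy₂, rfl⟩ := hy
    obtain ⟨x₂, h₂, hrun₂⟩ := ih ho' hy₂
    exact ⟨x₁ ++ x₂, h₁.append h₂, hrun₁.append hrun₂⟩

/-- Soundness of the triple construction. -/
lemma interp_output_le_tripleMeaning (i : TripleIndex emit read R S p₀ F) :
    interp (tripleMeaning emit read R S p₀ F) (tripleRule emit read R S p₀ F i).output ≤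
      tripleMeaning emit read R S p₀ F (tripleRule emit read R S p₀ F i).input := by
  intro y hy
  rcases i with p | ⟨m, X, q⟩ | ⟨m, q⟩ | ⟨⟨r, p, q⟩, o⟩ | ⟨q, o⟩
  · obtain rfl : y = [] := hy
    exact ⟨[], .nil, .nil p⟩
  · obtain ⟨z, hz, rfl⟩ := mem_interp_map_terminal_append hy
    obtain ⟨x, hx, hrun⟩ := mem_interp_singleton.mp hz
    exact ⟨x, hx, .emit m.2 hrun⟩
  · obtain ⟨x, hx, hrun⟩ := mem_interp_singleton.mp hy
    cases hx
    exact ⟨[m.1.2.1], Yields.nil.terminal _, .read m.2 hrun⟩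
  · obtain ⟨x, hx, hrun⟩ := exists_run_of_mem_interp_threads o.2 hy
    exact ⟨x, .of_rule r.2 hx, hrun⟩
  · obtain ⟨x, hx, hrun⟩ := exists_run_of_mem_interp_threads o.2 hy
    exact ⟨x, hx, q.1, q.2, hrun⟩

lemma yields_triple_of_run {p q : Q} {X : Option B} {y : List C}
    (h : Run emit read p X.toList y q) :
    Yields (Set.range (tripleRule emit read R S p₀ F))
      [Symbol.nonterminal (some (p, X.map Symbol.terminal, q))] y := by
  generalize hx : X.toList = x at h
  induction h generalizing X with
  | nil p =>
    obtain rfl : X = none := by simpa using hx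
    exact yields_tripleRule (.inl p) .nil
  | @emit p p' q x y z h _ ih =>
    exact yields_tripleRule (.inr (.inl (⟨_, h⟩, X, q))) ((Yields.map_terminal _ y).append (ih hx))
  | @read p p' q b x z h _ ih =>
    rcases X with _ | b'
    · cases hx
    · obtain ⟨rfl, rfl⟩ := List.cons_eq_cons.mp hx
      exact yields_tripleRule (.inr (.inr (.inl (⟨_, h⟩, q)))) (ih (X := none) rfl)

/-- Completeness of the triple construction. -/
lemma exists_threads_of_run {s : List (Symbol B N)} {x : List B} (h : Yields R s x) {p q : Q}
    {y : List C} (hrun : Run emit read p x y q) :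
    ∃ o ∈ threads C q p s, Yields (Set.range (tripleRule emit read R S p₀ F)) o y := by
  induction h generalizing p q y with
  | nil => exact ⟨_, rfl, yields_triple_of_run (X := none) hrun⟩
  | @terminal b s x _ ih =>
    obtain ⟨r, y₁, y₂, rfl, h₁, h₂⟩ := Run.exists_of_append (x := [b]) hrun
    obtain ⟨o, ho, hy⟩ := ih h₂
    exact ⟨_, Set.mem_iUnion.mpr ⟨r, o, ho, rfl⟩, (yields_triple_of_run (X := some b) h₁).append hy⟩
  | nonterminal hr _ _ ihv ihw =>
    obtain ⟨r, y₁, y₂, rfl, h₁, h₂⟩ := hrun.exists_of_append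
    obtain ⟨o₁, ho₁, hy₁⟩ := ihv h₁
    obtain ⟨o, ho, hy⟩ := ihw h₂
    exact ⟨_, Set.mem_iUnion.mpr ⟨r, o, ho, rfl⟩,
      (yields_tripleRule (.inr (.inr (.inr (.inl ⟨(⟨_, hr⟩, p, r), ⟨_, ho₁⟩⟩)))) hy₁).append hy⟩

/-- Finite transducers preserve context-free languages. -/
lemma isContextFree_run [Finite Q] [Finite B] (hemit : emit.Finite) {L : Language B}
    (hL : L.IsContextFree) (p₀ : Q) (F : Set Q) :
    Language.IsContextFree
      ({y | ∃ x ∈ L, ∃ q ∈ F, Run emit read p₀ x y q} : Language C) := by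
  obtain ⟨g, rfl⟩ := hL
  refine Eq.mpr (congrArg Language.IsContextFree ?_) (isContextFree_of_yields
    (finite_range_tripleRule (read := read) (S := g.initial) (p₀ := p₀) (F := F) hemit
      g.rules.finite_toSet) none)
  ext y
  constructor
  · rintro ⟨x, hx, q, hq, hrun⟩
    rw [ContextFreeGrammar.mem_language_iff, derives_iff_yields] at hx
    obtain ⟨o, ho, hy⟩ := exists_threads_of_run hx hrun
    exact yields_tripleRule (.inr (.inr (.inr (.inr ⟨⟨q, hq⟩, ⟨o, ho⟩⟩)))) hy
  · intro h
    obtain ⟨x, hx, q, hq, hrun⟩ :=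
      mem_interp_singleton.mp (h.mem_interp (Set.forall_mem_range.mpr interp_output_le_tripleMeaning))
    refine ⟨x, ?_, q, hq, hrun⟩
    rw [ContextFreeGrammar.mem_language_iff, derives_iff_yields]
    exact hx

end Transducer

/-! ### Images under rational transductions -/

namespace Correspondence

variable {B C D : Type u}

lemma mem_rel_iff (X : Correspondence B C) (u : FreeMonoid B) (v : FreeMonoid C) :
    (u, v) ∈ X.rel ↔ ∃ w ∈ X.lang, onWords X.α w = u.toList ∧ onWords X.β w = v.toList := by
  constructor
  · rintro ⟨w, hw, h⟩
    obtain ⟨rfl, rfl⟩ := Prod.mk.inj h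
    exact ⟨w.toList, hw, rfl, rfl⟩
  · rintro ⟨w, hw, rfl, rfl⟩
    exact ⟨FreeMonoid.ofList w, hw, rfl⟩

lemma mem_image_iff (X : Correspondence B C) (Ω : Language B) (v : List C) :
    v ∈ X.image Ω ↔ ∃ w ∈ X.lang, onWords X.α w ∈ Ω ∧ onWords X.β w = v :=
  ⟨fun ⟨w, h₁, h₂, h₃⟩ => ⟨w.toList, h₂, h₁, h₃⟩,
    fun ⟨w, h₁, h₂, h₃⟩ => ⟨FreeMonoid.ofList w, h₂, h₁, h₃⟩⟩

lemma mem_image_iff_rel (X : Correspondence B C) (Ω : Language B) (v : List C) :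
    v ∈ X.image Ω ↔ ∃ u ∈ Ω, (FreeMonoid.ofList u, FreeMonoid.ofList v) ∈ X.rel := by
  simp only [mem_image_iff, mem_rel_iff]
  constructor
  · rintro ⟨w, h₁, h₂, rfl⟩
    exact ⟨_, h₂, w, h₁, rfl, rfl⟩
  · rintro ⟨_, h₂, w, h₁, rfl, rfl⟩
    exact ⟨w, h₁, h₂, rfl⟩

lemma isRegular_image [Finite C] {X : Correspondence B C} (hX : X.IsRational) {Ω : Language B}
    (hΩ : Ω.IsRegular) : (X.image Ω).IsRegular := by
  have := X.finite_alphabet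
  refine Eq.mpr (congrArg Language.IsRegular ?_)
    (CFL.isRegular_image X.β (hX.inf (isRegular_preimage X.α hΩ)))
  ext v
  simp only [mem_image_iff]
  exact exists_congr fun w => and_assoc.symm

section Machine

variable (X : Correspondence B C) {σ : Type} (M : DFA X.alphabet σ) (N : ℕ)

/-- The states of a transducer for `X`: a state of an automaton for the language of `X`, and the
part of `α(w)` that has not yet been matched with the input. -/
abbrev MachineState (B : Type u) (σ : Type) (N : ℕ) := σ × {t : List B // t.length ≤ N}

/-- When nothing is left to match, the transducer guesses the next letter `a` of `w` and writes
`β(a)`. -/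
def machineEmit (hN : ∀ a, (X.α (FreeMonoid.of a)).toList.length ≤ N) :
    Set (MachineState B σ N × List C × MachineState B σ N) :=
  Set.range fun x : σ × X.alphabet =>
    ((x.1, ⟨[], Nat.zero_le N⟩), (X.β (FreeMonoid.of x.2)).toList,
      (M.step x.1 x.2, ⟨(X.α (FreeMonoid.of x.2)).toList, hN x.2⟩))

/-- The transducer reads the first letter of the part that is still to be matched. -/
def machineRead (B : Type u) (σ : Type) (N : ℕ) :
    Set (MachineState B σ N × B × MachineState B σ N) :=
  {m | m.1.1 = m.2.2.1 ∧ m.1.2.1 = m.2.1 :: m.2.2.2.1}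

variable {X M N} {hN : ∀ a, (X.α (FreeMonoid.of a)).toList.length ≤ N}

lemma exists_word_of_run {p q : MachineState B σ N} {x : List B} {y : List C}
    (h : Run (X.machineEmit M N hN) (machineRead B σ N) p x y q) :
    ∃ w, p.2.1 ++ onWords X.α w = x ++ q.2.1 ∧ onWords X.β w = y ∧ M.evalFrom p.1 w = q.1 := by
  induction h with
  | nil p => exact ⟨[], by simp⟩
  | emit h _ ih =>
    obtain ⟨⟨s, a⟩, h⟩ := h
    cases h
    obtain ⟨w, h₁, rfl, h₃⟩ := ih
    exact ⟨a :: w, by simpa using h₁, by simp, h₃⟩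
  | read h _ ih =>
    obtain ⟨w, h₁, h₂, h₃⟩ := ih
    obtain ⟨hs, ht⟩ := h
    dsimp only at hs ht
    exact ⟨w, by rw [ht, List.cons_append, h₁, List.cons_append], h₂, by rw [hs, h₃]⟩

lemma run_of_pending {s : σ} {x : List B} {y : List C} {q : MachineState B σ N}
    (h : Run (X.machineEmit M N hN) (machineRead B σ N) (s, ⟨[], Nat.zero_le N⟩) x y q)
    (t : List B) (ht : t.length ≤ N) :
    Run (X.machineEmit M N hN) (machineRead B σ N) (s, ⟨t, ht⟩) (t ++ x) y q := by
  induction t with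
  | nil => exact h
  | cons b t ih =>
    exact .read (p' := (s, ⟨t, (Nat.le_succ _).trans ht⟩)) ⟨rfl, rfl⟩ (ih _)

lemma run_of_word (w : List X.alphabet) (s : σ) :
    Run (X.machineEmit M N hN) (machineRead B σ N) (s, ⟨[], Nat.zero_le N⟩) (onWords X.α w)
      (onWords X.β w) (M.evalFrom s w, ⟨[], Nat.zero_le N⟩) := by
  induction w generalizing s with
  | nil => simpa using Run.nil _
  | cons a w ih =>
    rw [onWords_cons, onWords_cons]
    exact .emit ⟨(s, a), rfl⟩ (run_of_pending (ih _) _ (hN a))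

end Machine

lemma isContextFree_image [Finite B] {X : Correspondence B C} (hX : X.IsRational) {Ω : Language B}
    (hΩ : Ω.IsContextFree) : (X.image Ω).IsContextFree := by
  have := X.finite_alphabet
  obtain ⟨σ, _, M, hM⟩ := hX
  obtain ⟨N, hN⟩ := exists_length_le X.α
  have : Finite {t : List B // t.length ≤ N} := List.finite_length_le B N
  refine Eq.mpr (congrArg Language.IsContextFree ?_) (isContextFree_run
    (emit := X.machineEmit M N hN) (read := machineRead B σ N) (Set.finite_range _) hΩ
    (M.start, ⟨[], Nat.zero_le N⟩) {q | q.1 ∈ M.accept ∧ q.2.1 = []})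
  ext v
  rw [mem_image_iff, ← hM]
  constructor
  · rintro ⟨w, hw, hα, rfl⟩
    exact ⟨_, hα, (M.evalFrom M.start w, ⟨[], Nat.zero_le N⟩), ⟨hw, rfl⟩, run_of_word w M.start⟩
  · rintro ⟨x, hx, ⟨s, t⟩, ⟨hs, ht⟩, hrun⟩
    obtain ⟨w, h₁, rfl, h₃⟩ := exists_word_of_run hrun
    dsimp only at hs ht h₁ h₃
    obtain rfl : onWords X.α w = x := by simpa [ht] using h₁
    refine ⟨w, ?_, hx, rfl⟩
    rw [← h₃] at hs
    exact hs

/-! ### The fibred product -/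

lemma exists_shuffle {A A' : Type u} (u : List A) (v : List A') :
    ∃ w, onWords (projLeft A A') w = u ∧ onWords (projRight A A') w = v := by
  induction u with
  | nil =>
    induction v with
    | nil => exact ⟨[], by simp⟩
    | cons b v ih =>
      obtain ⟨w, h₁, h₂⟩ := ih
      exact ⟨Sum.inr b :: w, by simp [h₁], by simp [h₂]⟩
  | cons a u ih =>
    obtain ⟨w, h₁, h₂⟩ := ih
    exact ⟨Sum.inl a :: w, by simp [h₁], by simp [h₂]⟩

lemma mem_comp_lang_iff (Y : Correspondence C D) (X : Correspondence B C)
    (w : List (X.alphabet ⊕ Y.alphabet)) :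
    w ∈ (Y.comp X).lang ↔ onWords (projLeft _ _) w ∈ X.lang ∧ onWords (projRight _ _) w ∈ Y.lang ∧
      onWords X.β (onWords (projLeft _ _) w) = onWords Y.α (onWords (projRight _ _) w) :=
  Iff.rfl

/-- Any language of shuffles that is contained in the fibred-product language, and that has a
shuffle of every compatible pair, defines the composite of the two relations. -/
lemma rel_withLang_comp (Y : Correspondence C D) (X : Correspondence B C)
    (K : Language (Y.comp X).alphabet) (hK : K ≤ (Y.comp X).lang)
    (hK' : ∀ u ∈ X.lang, ∀ v ∈ Y.lang, onWords X.β u = onWords Y.α v →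
      ∃ w ∈ K, onWords (projLeft X.alphabet Y.alphabet) w = u ∧
        onWords (projRight X.alphabet Y.alphabet) w = v) :
    ((Y.comp X).withLang K).rel = {p | ∃ m, (p.1, m) ∈ X.rel ∧ (m, p.2) ∈ Y.rel} := by
  ext ⟨x, y⟩
  simp only [Set.mem_ofPred_eq, mem_rel_iff]
  constructor
  · rintro ⟨w, hw, hx, hy⟩
    obtain ⟨h₁, h₂, h₃⟩ := (mem_comp_lang_iff Y X w).mp (hK hw)
    exact ⟨FreeMonoid.ofList _, ⟨_, h₁, hx, rfl⟩, ⟨_, h₂, h₃.symm, hy⟩⟩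
  · rintro ⟨m, ⟨u, hu, hx, hm⟩, ⟨v, hv, hm', hy⟩⟩
    obtain ⟨w, hw, rfl, rfl⟩ := hK' u hu v hv (hm.trans hm'.symm)
    exact ⟨w, hw, hx, hy⟩

/-- The fibred product defines the composite of the relations that its factors define. -/
lemma rel_comp (Y : Correspondence C D) (X : Correspondence B C) :
    (Y.comp X).rel = {p | ∃ m, (p.1, m) ∈ X.rel ∧ (m, p.2) ∈ Y.rel} := by
  refine rel_withLang_comp Y X (Y.comp X).lang le_rfl fun u hu v hv h => ?_
  obtain ⟨w, rfl, rfl⟩ := exists_shuffle u v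
  exact ⟨w, (mem_comp_lang_iff Y X w).mpr ⟨hu, hv, h⟩, rfl, rfl⟩

lemma image_comp (Y : Correspondence C D) (X : Correspondence B C) (Ω : Language B) :
    (Y.comp X).image Ω = Y.image (X.image Ω) := by
  ext v
  simp only [mem_image_iff_rel, rel_comp]
  constructor
  · rintro ⟨u, hu, m, h₁, h₂⟩
    exact ⟨m.toList, ⟨u, hu, h₁⟩, h₂⟩
  · rintro ⟨m, ⟨u, hu, h₁⟩, h₂⟩
    exact ⟨u, hu, FreeMonoid.ofList m, h₁, h₂⟩

lemma image_congr {X X' : Correspondence B C} (h : X.rel = X'.rel) (Ω : Language B) :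
    X.image Ω = X'.image Ω := by
  ext v
  rw [mem_image_iff_rel, mem_image_iff_rel, h]

/-- The relation of the fibred product of rational transductions is already defined by a regular
part of its language. -/
lemma exists_isRegular_comp [Finite C] {X : Correspondence B C} {Y : Correspondence C D}
    (hX : X.IsRational) (hY : Y.IsRational) :
    ∃ K : Language (Y.comp X).alphabet, K.IsRegular ∧ K ≤ (Y.comp X).lang ∧
      ((Y.comp X).withLang K).rel = (Y.comp X).rel := by
  have := X.finite_alphabet
  have := Y.finite_alphabet
  obtain ⟨K, hK, hK₁, hK₂⟩ := exists_isRegular_shuffle X.β Y.α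
  have hle : ({w | onWords (projLeft _ _) w ∈ X.lang} ⊓ {w | onWords (projRight _ _) w ∈ Y.lang} ⊓
      K : Language (X.alphabet ⊕ Y.alphabet)) ≤ (Y.comp X).lang :=
    fun w hw => (mem_comp_lang_iff Y X w).mpr ⟨hw.1.1, hw.1.2, hK₁ w hw.2⟩
  refine ⟨_, ((isRegular_preimage (projLeft X.alphabet Y.alphabet) hX).inf
    (isRegular_preimage (projRight X.alphabet Y.alphabet) hY)).inf hK, hle, ?_⟩
  rw [rel_comp]
  refine rel_withLang_comp Y X _ hle fun u hu v hv h => ?_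
  obtain ⟨w, hw, rfl, rfl⟩ := hK₂ u v h
  exact ⟨w, ⟨⟨hu, hv⟩, hw⟩, rfl, rfl⟩

lemma IsMorphism.comp_withLang {L L' L'' : CFLang.{u}} {X : Correspondence L.alphabet L'.alphabet}
    {Y : Correspondence L'.alphabet L''.alphabet} (hX : X.IsMorphism L L')
    (hY : Y.IsMorphism L' L'') {K : Language (Y.comp X).alphabet} (hK : K.IsRegular)
    (hrel : ((Y.comp X).withLang K).rel = (Y.comp X).rel) :
    ((Y.comp X).withLang K).IsMorphism L L'' where
  rational := hK
  source_le v hv := by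
    obtain ⟨u, rfl⟩ := hX.source_le v hv
    obtain ⟨w, hw, -⟩ := exists_shuffle u.toList ([] : List Y.alphabet)
    exact ⟨FreeMonoid.ofList w, congrArg (onWords X.α) hw⟩
  target_le v hv := by
    obtain ⟨u, rfl⟩ := hY.target_le v hv
    obtain ⟨w, -, hw⟩ := exists_shuffle ([] : List X.alphabet) u.toList
    exact ⟨FreeMonoid.ofList w, congrArg (onWords Y.β) hw⟩
  image_le := by
    rw [image_congr hrel, image_comp]
    rintro v ⟨w, h₁, h₂, h₃⟩
    exact hY.image_le ⟨w, hX.image_le h₁, h₂, h₃⟩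

lemma isRelabelling_comp_assoc {B₁ B₂ B₃ B₄ : Type u} (X₁ : Correspondence B₁ B₂)
    (X₂ : Correspondence B₂ B₃) (X₃ : Correspondence B₃ B₄) :
    IsRelabelling (X₃.comp (X₂.comp X₁)) ((X₃.comp X₂).comp X₁)
      (Equiv.sumAssoc X₁.alphabet X₂.alphabet X₃.alphabet) := by
  let A₁ := X₁.alphabet
  let A₂ := X₂.alphabet
  let A₃ := X₃.alphabet
  let e := FreeMonoid.map (Equiv.sumAssoc A₁ A₂ A₃)
  have h₁ : (projLeft A₁ (A₂ ⊕ A₃)).comp e =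
      (projLeft A₁ A₂).comp (projLeft (A₁ ⊕ A₂) A₃) :=
    FreeMonoid.hom_eq (by rintro ((_ | _) | _) <;> rfl)
  have h₂ : ((projLeft A₂ A₃).comp (projRight A₁ (A₂ ⊕ A₃))).comp e =
      (projRight A₁ A₂).comp (projLeft (A₁ ⊕ A₂) A₃) :=
    FreeMonoid.hom_eq (by rintro ((_ | _) | _) <;> rfl)
  have h₃ : ((projRight A₂ A₃).comp (projRight A₁ (A₂ ⊕ A₃))).comp e =
      projRight (A₁ ⊕ A₂) A₃ :=
    FreeMonoid.hom_eq (by rintro ((_ | _) | _) <;> rfl)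
  refine ⟨?_, ?_, fun (w : FreeMonoid ((A₁ ⊕ A₂) ⊕ A₃)) => ?_⟩
  · exact congrArg X₁.α.comp h₁
  · exact congrArg X₃.β.comp h₃
  · have h₁ (w) : projLeft A₁ (A₂ ⊕ A₃) (e w) = projLeft A₁ A₂ (projLeft (A₁ ⊕ A₂) A₃ w) :=
      DFunLike.congr_fun h₁ w
    have h₂ (w) : projLeft A₂ A₃ (projRight A₁ (A₂ ⊕ A₃) (e w)) =
        projRight A₁ A₂ (projLeft (A₁ ⊕ A₂) A₃ w) :=
      DFunLike.congr_fun h₂ w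
    have h₃ (w) : projRight A₂ A₃ (projRight A₁ (A₂ ⊕ A₃) (e w)) = projRight (A₁ ⊕ A₂) A₃ w :=
      DFunLike.congr_fun h₃ w
    change (((projLeft A₁ A₂ (projLeft (A₁ ⊕ A₂) A₃ w)).toList ∈ X₁.lang ∧
      (projRight A₁ A₂ (projLeft (A₁ ⊕ A₂) A₃ w)).toList ∈ X₂.lang ∧
      X₁.β (projLeft A₁ A₂ (projLeft (A₁ ⊕ A₂) A₃ w)) =
        X₂.α (projRight A₁ A₂ (projLeft (A₁ ⊕ A₂) A₃ w))) ∧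
      (projRight (A₁ ⊕ A₂) A₃ w).toList ∈ X₃.lang ∧
      X₂.β (projRight A₁ A₂ (projLeft (A₁ ⊕ A₂) A₃ w)) = X₃.α (projRight (A₁ ⊕ A₂) A₃ w)) ↔
      ((projLeft A₁ (A₂ ⊕ A₃) (e w)).toList ∈ X₁.lang ∧
      ((projLeft A₂ A₃ (projRight A₁ (A₂ ⊕ A₃) (e w))).toList ∈ X₂.lang ∧
      (projRight A₂ A₃ (projRight A₁ (A₂ ⊕ A₃) (e w))).toList ∈ X₃.lang ∧
      X₂.β (projLeft A₂ A₃ (projRight A₁ (A₂ ⊕ A₃) (e w))) =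
        X₃.α (projRight A₂ A₃ (projRight A₁ (A₂ ⊕ A₃) (e w)))) ∧
      X₁.β (projLeft A₁ (A₂ ⊕ A₃) (e w)) =
        X₂.α (projLeft A₂ A₃ (projRight A₁ (A₂ ⊕ A₃) (e w))))
    rw [h₁, h₂, h₃]
    tauto

end Correspondence

/-! ### The category of context-free languages -/

namespace Mor

/-- The identity: the diagonal, defined by `(B, id, id, B*)`. -/
def id (L : CFLang.{u}) : Mor L L where
  rel := {p | p.1 = p.2}
  exists_rational := by
    refine ⟨⟨L.alphabet, L.finite_alphabet, MonoidHom.id _, MonoidHom.id _, ⊤⟩,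
      ⟨?_, fun v _ => ⟨FreeMonoid.ofList v, rfl⟩, fun v _ => ⟨FreeMonoid.ofList v, rfl⟩, ?_⟩, ?_⟩
    · exact ⟨Unit, inferInstance, ⟨fun _ _ => (), (), Set.univ⟩, rfl⟩
    · rintro v ⟨w, h, -, rfl⟩
      exact h
    · ext ⟨x, y⟩
      constructor
      · rintro ⟨w, -, h⟩
        cases h
        rfl
      · rintro (rfl : x = y)
        exact ⟨x, trivial, rfl⟩

/-- The composite of two morphisms is their composite as relations, which is the subset defined by
the fibred product of any correspondences that define them. -/
def comp {L L' L'' : CFLang.{u}} (f : Mor L L') (g : Mor L' L'') : Mor L L'' where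
  rel := {p | ∃ m, (p.1, m) ∈ f.rel ∧ (m, p.2) ∈ g.rel}
  exists_rational := by
    obtain ⟨X, hX, hf⟩ := f.exists_rational
    obtain ⟨Y, hY, hg⟩ := g.exists_rational
    have := L'.finite_alphabet
    obtain ⟨K, hK, -, hrel⟩ := Correspondence.exists_isRegular_comp hX.rational hY.rational
    exact ⟨_, hX.comp_withLang hY hK hrel, by rw [hrel, Correspondence.rel_comp, hf, hg]⟩

/-- Context-free languages with the relations defined by admissible rational transductions. -/
abbrev category : CategoryTheory.Category.{u, u + 1} CFLang.{u} where
  Hom := Mor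
  id := id
  comp := comp
  id_comp f := by
    ext p
    refine ⟨?_, fun h => ⟨p.1, rfl, h⟩⟩
    rintro ⟨m, h, h'⟩
    obtain rfl : p.1 = m := h
    exact h'
  comp_id f := by
    ext p
    refine ⟨?_, fun h => ⟨p.2, h, rfl⟩⟩
    rintro ⟨m, h, h'⟩
    obtain rfl : m = p.2 := h'
    exact h
  assoc f g h := by
    ext p
    exact ⟨fun ⟨m, ⟨m', h₁, h₂⟩, h₃⟩ => ⟨m', h₁, m, h₂, h₃⟩,
      fun ⟨m', h₁, m, h₂, h₃⟩ => ⟨m, ⟨m', h₁, h₂⟩, h₃⟩⟩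

end Mor

end CFL

theorem theorem2p5 :
    -- rational transductions preserve regular and context-free languages
    (∀ (B C : Type u) [Finite B] [Finite C] (X : CFL.Correspondence B C), X.IsRational →
      ∀ Ω : Language B,
        (Ω.IsRegular → (X.image Ω).IsRegular) ∧
        (Ω.IsContextFree → (X.image Ω).IsContextFree)) ∧
    -- the fibred product of two morphisms is again a morphism: its subset of `B* × D*` is already
    -- defined by a regular part of the fibred-product language
    (∀ (L L' L'' : CFL.CFLang.{u}) (X : CFL.Correspondence L.alphabet L'.alphabet)
      (Y : CFL.Correspondence L'.alphabet L''.alphabet), X.IsMorphism L L' → Y.IsMorphism L' L'' →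
        (Y.comp X).image L.lang = Y.image (X.image L.lang) ∧
        ∃ K : Language (Y.comp X).alphabet, K ≤ (Y.comp X).lang ∧
          ((Y.comp X).withLang K).rel = (Y.comp X).rel ∧
          ((Y.comp X).withLang K).IsMorphism L L'') ∧
    -- the fibred product is associative up to the relabelling `(A₁ ⊔ A₂) ⊔ A₃ ≃ A₁ ⊔ (A₂ ⊔ A₃)`
    (∀ (B₁ B₂ B₃ B₄ : Type u) (X₁ : CFL.Correspondence B₁ B₂) (X₂ : CFL.Correspondence B₂ B₃)
      (X₃ : CFL.Correspondence B₃ B₄),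
        CFL.Correspondence.IsRelabelling (X₃.comp (X₂.comp X₁)) ((X₃.comp X₂).comp X₁)
          (Equiv.sumAssoc X₁.alphabet X₂.alphabet X₃.alphabet)) ∧
    -- context-free languages and these morphisms form a category under this composition
    (∃ (i : ∀ L : CFL.CFLang.{u}, CFL.Mor L L)
      (c : ∀ {L L' L'' : CFL.CFLang.{u}}, CFL.Mor L L' → CFL.Mor L' L'' → CFL.Mor L L''),
        (∀ L : CFL.CFLang.{u}, (i L).rel = {p | p.1 = p.2}) ∧
        (∀ (L L' L'' : CFL.CFLang.{u}) (f : CFL.Mor L L') (g : CFL.Mor L' L'')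
          (X : CFL.Correspondence L.alphabet L'.alphabet)
          (Y : CFL.Correspondence L'.alphabet L''.alphabet),
            X.rel = f.rel → Y.rel = g.rel → (c f g).rel = (Y.comp X).rel) ∧
        ∃ 𝒞 : CategoryTheory.Category.{u, u + 1} CFL.CFLang.{u},
          𝒞.toCategoryStruct = { Hom := CFL.Mor, id := i, comp := c }) := by
  refine ⟨fun B C _ _ X hX Ω =>
      ⟨CFL.Correspondence.isRegular_image hX, CFL.Correspondence.isContextFree_image hX⟩,
    fun L L' L'' X Y hX hY => ⟨Y.image_comp X L.lang, ?_⟩,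
    fun _ _ _ _ => CFL.Correspondence.isRelabelling_comp_assoc,
    CFL.Mor.id, CFL.Mor.comp, fun _ => rfl, fun L L' L'' f g X Y hf hg => ?_,
    CFL.Mor.category, rfl⟩
  · have := L'.finite_alphabet
    obtain ⟨K, hK, hle, hrel⟩ := CFL.Correspondence.exists_isRegular_comp hX.rational hY.rational
    exact ⟨K, hle, hrel, hX.comp_withLang hY hK hrel⟩
  · rw [Y.rel_comp, hf, hg]
    rfl
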